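/- Let $m\ge 0$ and $N=2^m$. For $\bm a=(a_1,\dots,a_m)\in\mathbb F_2^m$ put $D(\bm a)=\sum_{k=1}^m 2^{k-1}(a_k\oplus 1)+1\in\{1,\dots,N\}$. The word $\mathrm{ev}(p)\in\mathbb F_2^N$ of a polynomial $p\in\mathbb F_2[x_1,\dots,x_m]/(x_k^2-x_k)$ has $p(\bm a)$ in position $D(\bm a)$, and $\mathrm{wt}(p)$ is its Hamming weight. The monomial $x_1^{a_1}\cdots x_m^{a_m}$ is numbered $f_t$ with $t=D(\bm a)$. For a set $\mathcal I$ of monomials let $C(\mathcal I)=\mathrm{span}\{\mathrm{ev}(f): f\in\mathcal I\}$; it is of $r$-th order if $r$ is the maximum degree of the monomials in $\mathcal I$, and $\mathcal I_r$ denotes the set of degree-$r$ monomials in $\mathcal I$. For $i_1<\dots<i_t$ and $j_1<\dots<j_t$ write $x_{i_1}\cdots x_{i_t}\preccurlyeq x_{j_1}\cdots x_{j_t}$ if $i_l\le j_l$ for all $l$; in general write $f\preccurlyeq g$ if $f\preccurlyeq g'$ for some factor $g'$ of $g$ with $\deg g'=\deg f$. A set $\mathcal I$ is decreasing if $f\preccurlyeq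 g\in\mathcal I$ implies $f\in\mathcal I$. Let $\bm q'$ be the bit-reversal sequence, $\bm q'_{D(a_m,\dots,a_1)}=D(a_1,\dots,a_m)$, and for $0\le i\le N$ let $Y'_i$ be the set of its last $i$ entries; a monomial $f_t$ is said to lie in $Y'_i$ if $t\in Y'_i$. For a set $W$ of words of length $N$, its shortening by $Y'_i$ is the set of the restrictions to the positions outside $Y'_i$ of those words in $W$ that vanish on all positions in $Y'_i$. Let $C_S(\mathcal I,Y'_i)$ be the shortening of $C(\mathcal I)$. For a decreasing set $\mathcal J$ of maximum degree $r$ and a degree-$r$ monomial $f=f_t\in\mathcal J$, let $T(f)$ be the set of the polynomials $p=\sum_{s} u_sf_s$ with $u_s=0$ for $s<t$, $u_t=1$, $u_s=0$ whenever $f_s\notin\mathcal J$, and $\mathrm{wt}(p)=\mathrm{wt}(f)$, and let $T_S(f,Y'_i)$ be the shortening of $\{\mathrm{ev}(p): p\in T(f)\}$. For $f=x_{i_1}\cdots x_{i_r}$ with $i_1<\dots<i_r$ let $\lambda_f=2^{\sum_{t=1}^r(i_t-t+1)}$, and let $\beta_f(i)$ be the number of factors of $f$ (including $1$ and $f$)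 that lie in $Y'_i$. Theorem. Let $\mathcal I$ be a set of monomials of maximum degree $r$ such that the union of $\mathcal I$ with the set of monomials in $Y'_i$ is decreasing, and let $d=2^{m-r}$. Then: 1. For every degree-$r$ monomial $f$, and every decreasing set $\mathcal J\ni f$ of maximum degree $r$ used to define $T(f)$, $$|T_S(f,Y'_i)|=\lambda_f\Bigl(1-\frac{\beta_f(i)}{2^r}\Bigr).$$ 2. The number of codewords of weight $d$ in $C_S(\mathcal I,Y'_i)$ is $$A_d(C_S(\mathcal I,Y'_i))=\sum_{f\in\mathcal I_r}\lambda_f\Bigl(1-\frac{\beta_f(i)}{2^r}\Bigr).$$ 3. If some $f\in\mathcal I_r$ does not lie in $Y'_i$, then $d$ is the minimum weight of the non-zero codewords of $C_S(\mathcal I,Y'_i)$. -/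

import Mathlib

namespace PolarShortening

/-- A square-free monomial in `x_1, …, x_m`, given by the set of its variables: `k : Fin m` stands
for the variable `x_{k+1}`. Its degree is `f.card`, and `g` is a factor of `f` iff `g ⊆ f`. -/
abbrev Mono (m : ℕ) := Finset (Fin m)

/-- A polynomial of `𝔽₂[x_1, …, x_m] / (x_k² - x_k)`, given by its coefficients. -/
abbrev Poly (m : ℕ) := Mono m → ZMod 2

/-- A point of `𝔽₂^m`. -/
abbrev Point (m : ℕ) := Fin m → ZMod 2

/-- A word of length `2^m`. The entry at the point `a` is the entry in position `D a`. -/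
abbrev Word (m : ℕ) := Point m → ZMod 2

/-- `D(a) = ∑_{k=1}^m 2^(k-1) (a_k ⊕ 1) + 1`, a number in `{1, …, 2^m}`. -/
def D {m : ℕ} (a : Point m) : ℕ :=
  (∑ k : Fin m, 2 ^ (k : ℕ) * (a k + 1).val) + 1

/-- The exponent vector of a monomial. -/
def exponents {m : ℕ} (f : Mono m) : Point m := fun k => if k ∈ f then 1 else 0

/-- The number `t = D(a_1, …, a_m)` of the monomial `f = x_1^{a_1} ⋯ x_m^{a_m}`, so `f = f_t`. -/
def index {m : ℕ} (f : Mono m) : ℕ := D (exponents f)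

/-- The evaluation vector of a polynomial. -/
def ev {m : ℕ} (p : Poly m) : Word m := fun a => ∑ f : Mono m, p f * ∏ k ∈ f, a k

/-- A monomial as a polynomial. -/
def toPoly {m : ℕ} (f : Mono m) : Poly m := Pi.single f 1

/-- The code `C(I)`: the span of the evaluation vectors of the monomials in `I`. -/
def code {m : ℕ} (I : Finset (Mono m)) : Submodule (ZMod 2) (Word m) :=
  Submodule.span (ZMod 2) ((fun f => ev (toPoly f)) '' (I : Set (Mono m)))

/-- `C(I)` is of `r`-th order: the maximum degree of the monomials in `I` is `r`. -/
def HasOrder {m : ℕ} (I : Finset (Mono m)) (r : ℕ) : Prop :=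
  IsGreatest {d : ℕ | ∃ f ∈ I, f.card = d} r

/-- The `l`-th smallest variable index of a monomial, with `l` counted from `0`
and the index of `x_k` counted as `k`. -/
def varIndex {m : ℕ} (f : Mono m) (l : Fin f.card) : ℕ :=
  ((f.orderEmbOfFin rfl l : Fin m) : ℕ) + 1

/-- `f ≼ g` for monomials of the same degree: componentwise comparison of the
increasingly ordered variable indices. -/
def PrecSameDeg {m : ℕ} (f g : Mono m) : Prop :=
  ∃ h : f.card = g.card, ∀ l : Fin f.card, varIndex f l ≤ varIndex g (Fin.cast h l)

/-- `f ≼ g` in general: `f ≼ g'` for a factor `g'` of `g` of the same degree as `f`. -/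
def Prec {m : ℕ} (f g : Mono m) : Prop := ∃ g' : Mono m, g' ⊆ g ∧ PrecSameDeg f g'

/-- Decreasing sets of monomials. -/
def IsDecreasing {m : ℕ} (I : Finset (Mono m)) : Prop :=
  ∀ f g : Mono m, Prec f g → g ∈ I → f ∈ I

/-- The last `i` entries of the bit-reversal sequence `q'` of length `2^m`, where
`q'_j = D(a_1, …, a_m)` for `j = D(a_m, …, a_1)`. -/
def bitRevPattern (m i : ℕ) : Finset ℕ :=
  (Finset.univ.filter fun a : Point m => 2 ^ m < D (fun k => a (Fin.rev k)) + i).image D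

/-- The monomials whose number lies in the pattern `Y`. -/
def monosIn {m : ℕ} (Y : Finset ℕ) : Finset (Mono m) :=
  Finset.univ.filter fun f : Mono m => index f ∈ Y

/-- Shortening a set of words by the pattern `Y`: the words that vanish on all positions in `Y`
are kept, and restricted to the positions outside `Y`. -/
def shorten {m : ℕ} (C : Set (Word m)) (Y : Finset ℕ) :
    Set ({a : Point m // D a ∉ Y} → ZMod 2) :=
  {c' | ∃ c ∈ C, (∀ a, D a ∈ Y → c a = 0) ∧ c' = fun a => c a.1}

/-- The shortened code `C_S(I, Y)`. -/
def shortenedCode {m : ℕ} (I : Finset (Mono m)) (Y : Finset ℕ) :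
    Set ({a : Point m // D a ∉ Y} → ZMod 2) :=
  shorten (code I : Set (Word m)) Y

/-- `A_d(C)`: the number of words of Hamming weight `d` in `C`. -/
noncomputable def numWeight {ι : Type*} [Fintype ι] (d : ℕ) (C : Set (ι → ZMod 2)) : ℕ :=
  {c ∈ C | hammingNorm c = d}.ncard

/-- `T(f)` for the information set `J`: the polynomials `p = ∑ u_i f_i` supported on `J`
whose first non-zero coefficient is that of `f` and which have the same weight as `f`. -/
def T {m : ℕ} (J : Finset (Mono m)) (f : Mono m) : Set (Poly m) :=
  {u | (∀ g, index g < index f → u g = 0) ∧ u f = 1 ∧ (∀ g, g ∉ J → u g = 0) ∧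
    hammingNorm (ev u) = hammingNorm (ev (toPoly f))}

/-- `T_S(f, Y)`: the words of `T(f)` (for the information set `J`), shortened by `Y`. -/
def TS {m : ℕ} (J : Finset (Mono m)) (f : Mono m) (Y : Finset ℕ) :
    Set ({a : Point m // D a ∉ Y} → ZMod 2) :=
  shorten (ev '' T J f) Y

/-- `λ_f = 2^{∑_{t=1}^r (i_t - t + 1)}` for `f = x_{i_1} ⋯ x_{i_r}`, `i_1 < ⋯ < i_r`.
Here `t = l + 1`; the subtraction never truncates, because `i_t ≥ t`. -/
def lam {m : ℕ} (f : Mono m) : ℕ :=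
  2 ^ ∑ l : Fin f.card, (varIndex f l - ((l : ℕ) + 1) + 1)

/-- `β_f(i)`: the number of factors of `f` among the last `i` entries of the bit-reversal
sequence. -/
def beta {m : ℕ} (f : Mono m) (i : ℕ) : ℕ :=
  (f.powerset.filter fun g => g ∈ monosIn (bitRevPattern m i)).card

end PolarShortening

namespace PolarShortening

variable {m : ℕ}

/-! A word of degree at most r and weight 2^(m-r) is the indicator of a flat of codimension r
(`exists_eq_flatWord`). Such a flat has a unique reduced echelon form (`flatWord_injective`): a set
f of r pivot variables and, for each k in f, an equation x_k = c_k + (a sum of some x_j with j < k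
and j outside f). The constants c_k form a subset C of f, the linear parts a subset A of `shearPairs
f`, and the pairs (C, A) number λ_f. Expanding the product of the equations yields only monomials ≼
f, with f itself occurring and having the least number; so, under `ev`, T(f) is the set of flats
with pivot set f.

Y'_i consists of the points whose bit-reversed binary value is below i. On a flat this value is
least where all free variables vanish, which is the exponent vector of C. Hence the flat avoids Y'_i
iff the monomial C is not in Y'_i (`flatWord_vanishes_iff`), and shortening removes β_f(i) of the
2^r choices of C.

The pattern is closed under factors, so a word vanishes on it iff its polynomial has no monomial in
it (`vanishes_on_bitRevPattern_iff`). A flat avoiding Y'_i with pivot set in I therefore has all its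
monomials in I as soon as the union is decreasing. This gives the count; the minimum weight follows
from the Reed–Muller bound `DegreeLT.le_hammingNorm`. -/

theorem zmod_two_eq (a : ZMod 2) : a = 0 ∨ a = 1 := by revert a; decide

theorem zmod_two_ne_zero {a : ZMod 2} : a ≠ 0 ↔ a = 1 := by revert a; decide

/-! ### Words and polynomials: Möbius inversion over 𝔽₂ -/

/-- The set of coordinates where a point is non-zero. -/
def pointSupport (x : Point m) : Mono m := Finset.univ.filter fun k => x k = 1

theorem mem_pointSupport {x : Point m} {k : Fin m} : k ∈ pointSupport x ↔ x k = 1 := by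
  simp [pointSupport]

@[simp] theorem exponents_pointSupport (x : Point m) : exponents (pointSupport x) = x := by
  funext k
  rcases zmod_two_eq (x k) with h | h <;> simp [exponents, pointSupport, h]

theorem exponents_injective : Function.Injective (exponents : Mono m → Point m) := by
  intro f g h
  ext k
  have := congrFun h k
  by_cases h1 : k ∈ f <;> by_cases h2 : k ∈ g <;> simp_all [exponents]

theorem prod_exponents (f h : Mono m) :
    ∏ k ∈ f, exponents h k = if f ⊆ h then (1 : ZMod 2) else 0 := by
  split_ifs with hs
  · exact Finset.prod_eq_one fun k hk => by simp [exponents, hs hk]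
  · obtain ⟨k, hk, hkh⟩ := Finset.not_subset.1 hs
    exact Finset.prod_eq_zero hk (by simp [exponents, hkh])

/-- The coefficient of a monomial in the polynomial with a given evaluation vector. -/
def coeff (F : Word m) (g : Mono m) : ZMod 2 := ∑ h ∈ g.powerset, F (exponents h)

/-- Möbius inversion mod 2: a monomial f contributes to the coefficient at g once for each element
of the interval [f, g], which has even size unless f = g. -/
theorem coeff_ev (u : Poly m) : coeff (ev u) = u := by
  funext g
  simp only [coeff, ev, prod_exponents]
  rw [Finset.sum_comm, Finset.sum_eq_single g]
  · rw [Finset.sum_eq_single g] <;> simp +contextual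
    intro b h1 h2 h3
    exact absurd (h1.antisymm h3) h2
  · intro f _ hfg
    have : ∀ h, u f * (if f ⊆ h then (1 : ZMod 2) else 0) = if f ⊆ h then u f else 0 := by
      intro h; split_ifs <;> simp
    simp only [this, ← Finset.sum_filter, Finset.sum_const]
    by_cases hs : f ⊆ g
    · have : g.powerset.filter (f ⊆ ·) = Finset.Icc f g := by
        ext h; simp [Finset.mem_Icc, and_comm]
      rw [this, Finset.card_Icc_finset hs]
      have hlt := Finset.card_lt_card (hs.ssubset_of_ne hfg)
      obtain ⟨n, hn⟩ := Nat.exists_eq_add_of_lt hlt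
      rw [show g.card - f.card = n + 1 by omega, pow_succ, mul_smul, two_nsmul,
        CharTwo.add_self_eq_zero, smul_zero]
    · rw [Finset.filter_eq_empty_iff.2]
      · simp
      · intro h hh hfh
        exact hs (hfh.trans (Finset.mem_powerset.1 hh))
  · simp

theorem ev_injective : Function.Injective (ev : Poly m → Word m) :=
  Function.LeftInverse.injective coeff_ev

theorem ev_coeff (F : Word m) : ev (coeff F) = F := by
  have hb : Function.Bijective (ev : Poly m → Word m) := by
    rw [Fintype.bijective_iff_injective_and_card]
    exact ⟨ev_injective, by simp⟩
  obtain ⟨u, rfl⟩ := hb.2 F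
  rw [coeff_ev]

theorem coeff_add (F G : Word m) (g : Mono m) : coeff (F + G) g = coeff F g + coeff G g := by
  simp [coeff, Finset.sum_add_distrib]

theorem coeff_smul (c : ZMod 2) (F : Word m) (g : Mono m) : coeff (c • F) g = c * coeff F g := by
  simp [coeff, Finset.mul_sum]

theorem coeff_zero (g : Mono m) : coeff (0 : Word m) g = 0 := by
  simp [coeff]

theorem eq_zero_of_coeff_eq_zero {F : Word m} (h : ∀ g, coeff F g = 0) : F = 0 := by
  rw [← ev_coeff F, show coeff F = 0 from funext h]
  funext a
  simp [ev]

theorem ev_toPoly (f : Mono m) (x : Point m) : ev (toPoly f) x = ∏ k ∈ f, x k := by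
  simp [ev, toPoly, Pi.single_apply]

theorem mem_code_iff {I : Finset (Mono m)} {F : Word m} :
    F ∈ code I ↔ ∀ g, g ∉ I → coeff F g = 0 := by
  constructor
  · intro h g hg
    refine Submodule.span_induction (p := fun F _ => coeff F g = 0) ?_ (coeff_zero g) ?_ ?_ h
    · rintro _ ⟨f, hf, rfl⟩
      rw [coeff_ev, toPoly, Pi.single_eq_of_ne]
      rintro rfl
      exact hg hf
    · intro x y _ _ hx hy
      rw [coeff_add, hx, hy, add_zero]
    · intro c x _ hx
      rw [coeff_smul, hx, mul_zero]
  · intro h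
    have hF : F = ∑ g, coeff F g • ev (toPoly g) := by
      conv_lhs => rw [← ev_coeff F]
      funext a
      simp [ev, toPoly, Pi.single_apply]
    rw [hF]
    refine Submodule.sum_mem _ fun g _ => ?_
    by_cases hg : g ∈ I
    · exact Submodule.smul_mem _ _ (Submodule.subset_span ⟨g, hg, rfl⟩)
    · rw [h g hg, zero_smul]
      exact Submodule.zero_mem _

/-! ### Derivatives along coordinates -/

/-- A point with one coordinate flipped. -/
def flipAt (k : Fin m) (x : Point m) : Point m := Function.update x k (x k + 1)

theorem flipAt_self (k : Fin m) (x : Point m) : flipAt k x k = x k + 1 := by simp [flipAt]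

theorem flipAt_of_ne {k j : Fin m} (h : j ≠ k) (x : Point m) : flipAt k x j = x j := by
  simp [flipAt, h]

theorem flipAt_flip (k : Fin m) (x : Point m) : flipAt k (flipAt k x) = x := by
  funext j
  by_cases h : j = k
  · subst h; simp [flipAt_self, add_assoc, CharTwo.add_self_eq_zero]
  · simp [flipAt_of_ne h]

theorem flipAt_comm (k j : Fin m) (x : Point m) :
    flipAt k (flipAt j x) = flipAt j (flipAt k x) := by
  by_cases hkj : k = j
  · rw [hkj]
  · simp only [flipAt, Function.update_of_ne hkj, Function.update_of_ne (Ne.symm hkj)]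
    exact Function.update_comm (Ne.symm hkj) _ _ _

theorem update_flipAt {k j : Fin m} (h : j ≠ k) (x : Point m) (a : ZMod 2) :
    Function.update (flipAt j x) k a = flipAt j (Function.update x k a) := by
  simp only [flipAt, Function.update_of_ne h]
  exact Function.update_comm h _ _ _

theorem flipAt_exponents_of_notMem {k : Fin m} {h : Mono m} (hk : k ∉ h) :
    flipAt k (exponents h) = exponents (insert k h) := by
  funext j
  by_cases hj : j = k
  · subst hj; simp [flipAt_self, exponents, hk]
  · simp [flipAt_of_ne hj, exponents, hj]

/-- The derivative of a word in the direction of a coordinate. -/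
def derivative (k : Fin m) (F : Word m) : Word m := fun x => F x + F (flipAt k x)

/-- The subsets of `insert k g` pair off as h and `insert k h`, whose exponent vectors differ by a
flip at k. -/
theorem coeff_derivative_of_notMem {k : Fin m} {g : Mono m} (hk : k ∉ g) (F : Word m) :
    coeff (derivative k F) g = coeff F (insert k g) := by
  rw [coeff, coeff, Finset.sum_powerset_insert hk]
  simp only [derivative, Finset.sum_add_distrib]
  congr 1
  refine Finset.sum_congr rfl fun h hh => ?_
  rw [flipAt_exponents_of_notMem fun hkh => hk (Finset.mem_powerset.1 hh hkh)]

theorem derivative_derivative (k : Fin m) (F : Word m) :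
    derivative k (derivative k F) = 0 := by
  funext x
  simp only [derivative, flipAt_flip, Pi.zero_apply]
  rw [add_comm (F (flipAt k x)), CharTwo.add_self_eq_zero]

theorem coeff_derivative_of_mem {k : Fin m} {g : Mono m} (hk : k ∈ g) (F : Word m) :
    coeff (derivative k F) g = 0 := by
  rw [← Finset.insert_erase hk, ← coeff_derivative_of_notMem (by simp), derivative_derivative,
    coeff_zero]

theorem coeff_eq_zero_of_derivative_eq_zero {k : Fin m} {F : Word m} (h : derivative k F = 0)
    {g : Mono m} (hk : k ∈ g) : coeff F g = 0 := by
  rw [← Finset.insert_erase hk, ← coeff_derivative_of_notMem (by simp), h, coeff_zero]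

/-- All monomials occurring in the polynomial of a word have degree less than `n`. -/
def DegreeLT (F : Word m) (n : ℕ) : Prop := ∀ g : Mono m, n ≤ g.card → coeff F g = 0

theorem DegreeLT.derivative {F : Word m} {n : ℕ} (h : DegreeLT F (n + 1)) (k : Fin m) :
    DegreeLT (derivative k F) n := by
  intro g hg
  by_cases hk : k ∈ g
  · exact coeff_derivative_of_mem hk F
  · rw [coeff_derivative_of_notMem hk]
    exact h _ (by rw [Finset.card_insert_of_notMem hk]; omega)

theorem eq_const_of_derivative_eq_zero {F : Word m} (h : ∀ k, derivative k F = 0) (x : Point m) :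
    F x = coeff F ∅ := by
  conv_lhs => rw [← ev_coeff F]
  rw [ev, Finset.sum_eq_single ∅]
  · simp
  · intro g _ hg
    obtain ⟨k, hk⟩ := Finset.nonempty_iff_ne_empty.2 hg
    rw [coeff_eq_zero_of_derivative_eq_zero (h k) hk, zero_mul]
  · simp

theorem eq_affine_of_coeff {F : Word m} (h : ∀ g, coeff F g ≠ 0 → g.card ≤ 1) (x : Point m) :
    F x = coeff F ∅ + ∑ j, coeff F {j} * x j := by
  conv_lhs => rw [← ev_coeff F]
  have hsub : insert ∅ (Finset.univ.map ⟨singleton, Finset.singleton_injective⟩) ⊆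
    (Finset.univ : Finset (Mono m)) := Finset.subset_univ _
  rw [ev, ← Finset.sum_subset hsub]
  · rw [Finset.sum_insert (by simp)]
    simp
  · intro g _ hg
    by_cases hc : coeff F g = 0
    · rw [hc, zero_mul]
    · exfalso
      simp only [Finset.mem_insert, Finset.mem_map, Finset.mem_univ, true_and,
        Function.Embedding.coeFn_mk, not_or, not_exists] at hg
      rcases Nat.le_one_iff_eq_zero_or_eq_one.1 (h g hc) with hc | hc
      · exact hg.1 (Finset.card_eq_zero.1 hc)
      · obtain ⟨j, rfl⟩ := Finset.card_eq_one.1 hc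
        exact hg.2 j rfl

/-! ### Hamming weight and the Reed–Muller bound -/

theorem hammingNorm_eq_sum_val {ι : Type*} [Fintype ι] (F : ι → ZMod 2) :
    hammingNorm F = ∑ x, (F x).val := by
  rw [hammingNorm, Finset.card_filter]
  refine Finset.sum_congr rfl fun x _ => ?_
  rcases zmod_two_eq (F x) with h | h <;> simp [h, ZMod.val_one]

theorem sum_flipAt {α : Type*} [AddCommMonoid α] (k : Fin m) (G : Point m → α) :
    ∑ x, G (flipAt k x) = ∑ x, G x :=
  Equiv.sum_comp (Function.Involutive.toPerm (flipAt k) (flipAt_flip k)) G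

/-- Inclusion–exclusion: the support of the derivative is the symmetric difference of the support of
F and its translate. -/
theorem hammingNorm_derivative (k : Fin m) (F : Word m) :
    hammingNorm (derivative k F) + 2 * ∑ x, (F x * F (flipAt k x)).val = 2 * hammingNorm F := by
  have key : ∀ a b : ZMod 2, (a + b).val + 2 * (a * b).val = a.val + b.val := by decide
  have h2 := sum_flipAt k fun x => (F x).val
  simp only [hammingNorm_eq_sum_val]
  calc _ = ∑ x, ((derivative k F x).val + 2 * (F x * F (flipAt k x)).val) := by
        rw [Finset.sum_add_distrib, Finset.mul_sum]
    _ = ∑ x, ((F x).val + (F (flipAt k x)).val) := Finset.sum_congr rfl fun x _ => key _ _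
    _ = _ := by rw [Finset.sum_add_distrib, h2, two_mul]

theorem hammingNorm_const_one {F : Word m} (h : ∀ x, F x = 1) : hammingNorm F = 2 ^ m := by
  simp [hammingNorm_eq_sum_val, h, ZMod.val_one]

/-- The minimum distance of the Reed–Muller codes. -/
theorem DegreeLT.le_hammingNorm {n : ℕ} : ∀ {F : Word m}, DegreeLT F n → F ≠ 0 →
    2 ^ m * 2 ≤ 2 ^ n * hammingNorm F := by
  induction n with
  | zero => exact fun h h0 => absurd (eq_zero_of_coeff_eq_zero fun g => h g (Nat.zero_le _)) h0
  | succ n ih =>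
    intro F h h0
    -- A derivative lowers the degree bound by one and at most doubles the weight; if all
    -- derivatives vanish, F is the constant 1. The factor 2 in the bound is there because n exceeds
    -- the largest permitted degree by one.
    by_cases hd : ∀ k, PolarShortening.derivative k F = 0
    · have hc := eq_const_of_derivative_eq_zero hd
      have hc1 : coeff F ∅ = 1 := by
        rw [← zmod_two_ne_zero]
        intro h1
        exact h0 (funext fun x => by rw [hc, h1, Pi.zero_apply])
      rw [hammingNorm_const_one (fun x => (hc x).trans hc1), pow_succ]
      nlinarith [Nat.one_le_two_pow (n := n), Nat.one_le_two_pow (n := m)]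
    · push Not at hd
      obtain ⟨k, hk⟩ := hd
      have h1 := ih (h.derivative k) hk
      have h2 : hammingNorm (PolarShortening.derivative k F) ≤ 2 * hammingNorm F := by
        rw [← hammingNorm_derivative k F]; omega
      calc 2 ^ m * 2 ≤ _ := h1
        _ ≤ 2 ^ n * (2 * hammingNorm F) := Nat.mul_le_mul_left _ h2
        _ = _ := by ring

/-! ### Flats in reduced echelon form -/

theorem exponents_of_notMem {f : Mono m} {k : Fin m} (h : k ∉ f) : exponents f k = 0 := by
  simp [exponents, h]

/-- The pairs `(k, j)` with `j` a variable preceding `k` outside of `f` and `k` a variable of `f`. -/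
def shearPairs (f : Mono m) : Finset (Σ _ : Fin m, Fin m) :=
  f.sigma fun k => Finset.univ.filter fun j => j < k ∧ j ∉ f

theorem mem_shearPairs {f : Mono m} {k j : Fin m} :
    (⟨k, j⟩ : Σ _ : Fin m, Fin m) ∈ shearPairs f ↔ k ∈ f ∧ j < k ∧ j ∉ f := by
  simp [shearPairs]

/-- The affine form `[k ∈ C] + ∑_{(k, j) ∈ A} x_j`. -/
def affineForm (C : Mono m) (A : Finset (Σ _ : Fin m, Fin m)) (x : Point m) (k : Fin m) : ZMod 2 :=
  exponents C k + ∑ j, if ⟨k, j⟩ ∈ A then x j else 0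

/-- The point of the flat `x_k = affineForm C A x k`, `k ∈ f`, with prescribed values of the
variables outside `f`. -/
def solve (f C : Mono m) (A : Finset (Σ _ : Fin m, Fin m)) (x : Point m) : Point m :=
  fun k => if k ∈ f then affineForm C A x k else x k

/-- The indicator word of the flat `x_k = affineForm C A x k`, `k ∈ f`. -/
def flatWord (f C : Mono m) (A : Finset (Σ _ : Fin m, Fin m)) : Word m :=
  fun x => ∏ k ∈ f, (x k + affineForm C A x k + 1)

theorem zmod_two_prod_eq_one_iff {ι : Type*} {s : Finset ι} {a : ι → ZMod 2} :
    ∏ i ∈ s, a i = 1 ↔ ∀ i ∈ s, a i = 1 := by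
  simp only [← zmod_two_ne_zero, Finset.prod_ne_zero_iff]

theorem flatWord_eq_one_iff {f C : Mono m} {A : Finset (Σ _ : Fin m, Fin m)} {x : Point m} :
    flatWord f C A x = 1 ↔ ∀ k ∈ f, x k = affineForm C A x k := by
  have key : ∀ a b : ZMod 2, a + b + 1 = 1 ↔ a = b := by decide
  simp only [flatWord, zmod_two_prod_eq_one_iff, key]

theorem flatWord_eq_one_iff_solve {f C : Mono m} {A : Finset (Σ _ : Fin m, Fin m)} {x : Point m} :
    flatWord f C A x = 1 ↔ solve f C A x = x := by
  rw [flatWord_eq_one_iff, funext_iff]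
  refine forall_congr' fun k => ?_
  by_cases hk : k ∈ f <;> simp [solve, hk, eq_comm]

/-- The echelon form is reduced: no pivot variable occurs on a right-hand side, so the free
variables below k determine the value at k. -/
theorem affineForm_congr {f C : Mono m} {A : Finset (Σ _ : Fin m, Fin m)} (hA : A ⊆ shearPairs f)
    {x y : Point m} {k : Fin m} (h : ∀ j, j < k → j ∉ f → x j = y j) :
    affineForm C A x k = affineForm C A y k := by
  unfold affineForm
  congr 1
  refine Finset.sum_congr rfl fun j _ => ?_
  split_ifs with hj
  · have := mem_shearPairs.1 (hA hj)
    exact h j this.2.1 this.2.2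
  · rfl

theorem solve_congr {f C : Mono m} {A : Finset (Σ _ : Fin m, Fin m)} (hA : A ⊆ shearPairs f)
    {x y : Point m} (h : ∀ j, j ∉ f → x j = y j) : solve f C A x = solve f C A y := by
  funext k
  by_cases hk : k ∈ f
  · simpa [solve, hk] using affineForm_congr hA fun j _ => h j
  · simpa [solve, hk] using h k hk

theorem solve_of_notMem {f C : Mono m} {A : Finset (Σ _ : Fin m, Fin m)} {k : Fin m} (hk : k ∉ f)
    (x : Point m) : solve f C A x k = x k := by simp [solve, hk]

theorem flatWord_solve {f C : Mono m} {A : Finset (Σ _ : Fin m, Fin m)} (hA : A ⊆ shearPairs f)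
    (x : Point m) : flatWord f C A (solve f C A x) = 1 :=
  flatWord_eq_one_iff_solve.2 (solve_congr hA fun _ hj => solve_of_notMem hj x)

theorem flatWord_exponents {f C : Mono m} {A : Finset (Σ _ : Fin m, Fin m)}
    (hA : A ⊆ shearPairs f) (hC : C ⊆ f) : flatWord f C A (exponents C) = 1 := by
  rw [flatWord_eq_one_iff]
  intro k _
  rw [affineForm, Finset.sum_eq_zero, add_zero]
  intro j _
  split_ifs with hj
  · have := (mem_shearPairs.1 (hA hj)).2.2
    exact exponents_of_notMem fun h => this (hC h)
  · rfl

/-- The flat determines its pivot values as functions of the free variables. Evaluation at 0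
recovers C, and evaluation at the unit vectors then recovers A. -/
theorem flatWord_injective {f C C' : Mono m} {A A' : Finset (Σ _ : Fin m, Fin m)}
    (hA : A ⊆ shearPairs f) (hC : C ⊆ f) (hA' : A' ⊆ shearPairs f) (hC' : C' ⊆ f)
    (h : flatWord f C A = flatWord f C' A') : C = C' ∧ A = A' := by
  have hs : ∀ x, solve f C A x = solve f C' A' x := fun x => by
    have h1 := flatWord_solve (C := C) hA x
    rw [h, flatWord_eq_one_iff_solve] at h1
    rw [← h1]
    exact solve_congr hA' fun _ hj => solve_of_notMem hj x
  have hform : ∀ k ∈ f, ∀ x, affineForm C A x k = affineForm C' A' x k := fun k hk x => by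
    simpa [solve, hk] using congrFun (hs x) k
  have hexp : ∀ k ∈ f, exponents C k = exponents C' k := fun k hk => by
    simpa [affineForm] using hform k hk 0
  constructor
  · apply exponents_injective
    funext k
    by_cases hk : k ∈ f
    · exact hexp k hk
    · rw [exponents_of_notMem fun h => hk (hC h), exponents_of_notMem fun h => hk (hC' h)]
  · ext ⟨k, j⟩
    by_cases hk : k ∈ f
    · have := hform k hk (Pi.single j 1)
      simp only [affineForm, hexp k hk, add_right_inj, Pi.single_apply, ← ite_and] at this
      have h2 : ∀ B : Finset (Σ _ : Fin m, Fin m),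
          (∑ i, if ⟨k, i⟩ ∈ B ∧ i = j then (1 : ZMod 2) else 0) = if ⟨k, j⟩ ∈ B then 1 else 0 := by
        intro B
        rw [Finset.sum_eq_single j] <;> simp +contextual
      rw [h2, h2] at this
      by_cases h3 : (⟨k, j⟩ : Σ _ : Fin m, Fin m) ∈ A <;>
      by_cases h4 : (⟨k, j⟩ : Σ _ : Fin m, Fin m) ∈ A' <;> simp_all
    · exact iff_of_false (fun h => hk (mem_shearPairs.1 (hA h)).1)
        fun h => hk (mem_shearPairs.1 (hA' h)).1

/-- The affine involution carrying the monomial `f` to the flat word. -/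
def shear (f C : Mono m) (A : Finset (Σ _ : Fin m, Fin m)) (x : Point m) : Point m :=
  fun k => if k ∈ f then x k + affineForm C A x k + 1 else x k

/-- The shear fixes the free variables, hence the affine forms, and adds the same amount to each
pivot twice. -/
theorem shear_involutive {f C : Mono m} {A : Finset (Σ _ : Fin m, Fin m)}
    (hA : A ⊆ shearPairs f) : Function.Involutive (shear f C A) := by
  intro x
  have key : ∀ a b : ZMod 2, a + b + 1 + b + 1 = a := by decide
  funext k
  by_cases hk : k ∈ f
  · have h : affineForm C A (shear f C A x) k = affineForm C A x k :=
      affineForm_congr hA fun j _ hj => by simp [shear, hj]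
    rw [shear, if_pos hk, h, shear, if_pos hk, key]
  · simp [shear, hk]

theorem hammingNorm_flatWord_eq {f C : Mono m} {A : Finset (Σ _ : Fin m, Fin m)}
    (hA : A ⊆ shearPairs f) : hammingNorm (flatWord f C A) = hammingNorm (ev (toPoly f)) := by
  rw [hammingNorm_eq_sum_val, hammingNorm_eq_sum_val, ← Equiv.sum_comp
    (shear_involutive (C := C) hA).toPerm fun x => (ev (toPoly f) x).val]
  refine Finset.sum_congr rfl fun x _ => ?_
  congr 1
  rw [ev_toPoly, flatWord]
  exact Finset.prod_congr rfl fun k hk => by simp [shear, hk]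

theorem pow_mul_hammingNorm_toPoly (f : Mono m) :
    2 ^ f.card * hammingNorm (ev (toPoly f)) = 2 ^ m := by
  have h : (Finset.univ.filter fun x : Point m => ev (toPoly f) x ≠ 0) =
      Fintype.piFinset fun k => if k ∈ f then {1} else Finset.univ := by
    ext x
    simp only [Finset.mem_filter, Finset.mem_univ, true_and, ev_toPoly, zmod_two_ne_zero,
      zmod_two_prod_eq_one_iff, Fintype.mem_piFinset]
    refine forall_congr' fun k => ?_
    by_cases hk : k ∈ f <;> simp [hk]
  have h2 : ∀ k, (if k ∈ f then ({1} : Finset (ZMod 2)) else Finset.univ).card =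
      if k ∈ f then 1 else 2 := by
    intro k
    split_ifs <;> simp [ZMod.card]
  rw [hammingNorm, h, Fintype.card_piFinset]
  simp only [h2]
  rw [← Finset.prod_const, ← Fintype.prod_ite_mem, ← Finset.prod_mul_distrib]
  have h3 : ∀ k, ((if k ∈ f then 2 else 1) * if k ∈ f then 1 else 2) = 2 := by
    intro k
    split_ifs <;> rfl
  simp [h3]

theorem hammingNorm_toPoly (f : Mono m) : hammingNorm (ev (toPoly f)) = 2 ^ (m - f.card) := by
  have h := pow_mul_hammingNorm_toPoly f
  have hf : f.card ≤ m := by simpa using Finset.card_le_univ f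
  refine Nat.eq_of_mul_eq_mul_left (pow_pos two_pos f.card) (h.trans ?_)
  rw [← pow_add, Nat.add_sub_cancel' hf]

/-- The coefficient of the leading monomial of a flat word. -/
theorem coeff_flatWord_self {f C : Mono m} {A : Finset (Σ _ : Fin m, Fin m)}
    (hA : A ⊆ shearPairs f) (hC : C ⊆ f) : coeff (flatWord f C A) f = 1 := by
  -- The sum runs over points whose free variables vanish; C is the only one of them on the flat.
  rw [coeff, Finset.sum_eq_single C]
  · exact flatWord_exponents hA hC
  · intro t ht htC
    by_contra hne
    have h1 := flatWord_eq_one_iff_solve.1 (zmod_two_ne_zero.1 hne)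
    have h2 := flatWord_eq_one_iff_solve.1 (flatWord_exponents hA hC)
    apply htC
    apply exponents_injective
    rw [← h1, ← h2]
    refine solve_congr hA fun j hj => ?_
    rw [exponents_of_notMem fun h => hj (hC h),
      exponents_of_notMem fun h => hj (Finset.mem_powerset.1 ht h)]
  · exact fun h => absurd (Finset.mem_powerset.2 hC) h

/-! ### Monomials of a flat and the order ≼ -/

/-- The variables of `g` can be matched injectively with variables of `f` that are not smaller. -/
def EmbedsBelow (g f : Mono m) : Prop :=
  ∃ φ : Fin m → Fin m, Set.InjOn φ g ∧ (∀ j ∈ g, φ j ∈ f) ∧ ∀ j ∈ g, j ≤ φ j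

theorem EmbedsBelow.mono {g f f' : Mono m} (h : EmbedsBelow g f) (hf : f ⊆ f') :
    EmbedsBelow g f' := by
  obtain ⟨φ, h1, h2, h3⟩ := h
  exact ⟨φ, h1, fun j hj => hf (h2 j hj), h3⟩

theorem EmbedsBelow.insert {g f : Mono m} (h : EmbedsBelow g f) {j k : Fin m} (hk : k ∉ f)
    (hjk : j ≤ k) : EmbedsBelow (insert j g) (insert k f) := by
  by_cases hj : j ∈ g
  · rw [Finset.insert_eq_of_mem hj]
    exact h.mono (Finset.subset_insert _ _)
  · obtain ⟨φ, h1, h2, h3⟩ := h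
    have hne : ∀ i ∈ g, i ≠ j := fun i hi h => hj (h ▸ hi)
    refine ⟨Function.update φ j k, ?_, ?_, ?_⟩
    · intro a ha b hb hab
      rw [Finset.mem_coe, Finset.mem_insert] at ha hb
      rcases ha with rfl | ha <;> rcases hb with rfl | hb
      · rfl
      · rw [Function.update_self, Function.update_of_ne (hne b hb)] at hab
        exact absurd (hab ▸ h2 b hb) hk
      · rw [Function.update_self, Function.update_of_ne (hne a ha)] at hab
        exact absurd (hab ▸ h2 a ha) hk
      · rw [Function.update_of_ne (hne a ha), Function.update_of_ne (hne b hb)] at hab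
        exact h1 ha hb hab
    · intro i hi
      rcases Finset.mem_insert.1 hi with rfl | hi
      · simp
      · rw [Function.update_of_ne (hne i hi)]
        exact Finset.mem_insert_of_mem (h2 i hi)
    · intro i hi
      rcases Finset.mem_insert.1 hi with rfl | hi
      · simpa using hjk
      · rw [Function.update_of_ne (hne i hi)]
        exact h3 i hi

theorem mul_coordinate_mem_code {I I' : Finset (Mono m)} {j : Fin m}
    (h : ∀ g ∈ I, insert j g ∈ I') {F : Word m} (hF : F ∈ code I) :
    (fun x => F x * x j) ∈ code I' := by
  refine Submodule.span_induction (p := fun F _ => (fun x => F x * x j) ∈ code I') ?_ ?_ ?_ ?_ hF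
  · rintro _ ⟨g, hg, rfl⟩
    refine Submodule.subset_span ⟨insert j g, h g hg, ?_⟩
    funext x
    have key : ∀ a : ZMod 2, a = a * a := by decide
    by_cases hj : j ∈ g
    · rw [Finset.insert_eq_of_mem hj]
      dsimp only
      rw [ev_toPoly, ← Finset.mul_prod_erase g _ hj, mul_right_comm, ← key]
    · dsimp only
      rw [ev_toPoly, ev_toPoly, Finset.prod_insert hj, mul_comm]
  · have : (fun x => (0 : Word m) x * x j) = 0 := by
      funext x; simp
    rw [this]
    exact (code I').zero_mem
  · intro F G _ _ hF hG
    have : (fun x => (F + G) x * x j) = (fun x => F x * x j) + fun x => G x * x j := by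
      funext x; simp [add_mul]
    rw [this]
    exact (code I').add_mem hF hG
  · intro c F _ hF
    have : (fun x => (c • F) x * x j) = c • fun x => F x * x j := by
      funext x; simp [mul_assoc]
    rw [this]
    exact (code I').smul_mem c hF

open Classical in
-- The equation for k multiplies by a constant, by x_k or by some x_j with j ≤ k, each of which
-- extends a matching by at most one pair ending in k. The condition on A does not mention f, so the
-- induction can remove variables from f.
theorem flatWord_mem_code (C : Mono m) {A : Finset (Σ _ : Fin m, Fin m)}
    (hA : ∀ k j : Fin m, (⟨k, j⟩ : Σ _ : Fin m, Fin m) ∈ A → j ≤ k) (f : Mono m) :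
    flatWord f C A ∈ code (Finset.univ.filter fun g => EmbedsBelow g f) := by
  induction f using Finset.induction_on with
  | empty =>
    refine Submodule.subset_span ⟨∅, ?_, ?_⟩
    · simpa using ⟨id, by simp⟩
    · funext x
      simp [ev_toPoly, flatWord]
  | insert k f hk ih =>
    set N := code (Finset.univ.filter fun g => EmbedsBelow g (insert k f)) with hN
    have hx : ∀ j ≤ k, (fun x => flatWord f C A x * x j) ∈ N := fun j hj =>
      mul_coordinate_mem_code (fun g hg => by
        simp only [Finset.mem_filter, Finset.mem_univ, true_and] at hg ⊢
        exact hg.insert hk hj) ih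
    have h1 : flatWord f C A ∈ N := by
      refine Submodule.span_mono (Set.image_mono fun g hg => ?_) ih
      simp only [Finset.coe_filter, Finset.mem_univ, true_and, Set.mem_ofPred_eq] at hg ⊢
      exact hg.mono (Finset.subset_insert _ _)
    have hsplit : flatWord (insert k f) C A = (fun x => flatWord f C A x * x k) +
        (exponents C k • flatWord f C A + ∑ j, (if (⟨k, j⟩ : Σ _ : Fin m, Fin m) ∈ A then
          (fun x => flatWord f C A x * x j) else 0)) + flatWord f C A := by
      funext x
      have : flatWord (insert k f) C A x =
          (x k + affineForm C A x k + 1) * flatWord f C A x := by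
        rw [flatWord, Finset.prod_insert hk, flatWord]
      rw [this, affineForm]
      simp only [Pi.add_apply, Pi.smul_apply, smul_eq_mul, Finset.sum_apply, add_mul, one_mul,
        Finset.sum_mul]
      congr 2
      · exact mul_comm _ _
      · congr 1
        refine Finset.sum_congr rfl fun j _ => ?_
        split_ifs
        · exact mul_comm _ _
        · simp
    rw [hsplit]
    refine N.add_mem (N.add_mem (hx k le_rfl) (N.add_mem (N.smul_mem _ h1) ?_)) h1
    refine N.sum_mem fun j _ => ?_
    split_ifs with hj
    · exact hx j (hA k j hj)
    · exact N.zero_mem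

theorem embedsBelow_of_coeff_flatWord_ne_zero {f C g : Mono m}
    {A : Finset (Σ _ : Fin m, Fin m)} (hA : A ⊆ shearPairs f)
    (h : coeff (flatWord f C A) g ≠ 0) : EmbedsBelow g f := by
  by_contra hg
  exact h (mem_code_iff.1 (flatWord_mem_code C
    (fun k j hj => (mem_shearPairs.1 (hA hj)).2.1.le) f) g (by simpa using hg))

/-- Pigeonhole: were the l-th smallest element of the image below the l-th smallest of g, the
preimages of the l + 1 smallest elements of the image (l counted from 0) would all lie among the l
elements of g preceding the latter. -/
theorem EmbedsBelow.prec {g f : Mono m} (h : EmbedsBelow g f) : Prec g f := by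
  obtain ⟨φ, hinj, hmaps, hle⟩ := h
  have hcard : (g.image φ).card = g.card := Finset.card_image_of_injOn hinj
  refine ⟨g.image φ, Finset.image_subset_iff.2 hmaps, hcard.symm, fun l => ?_⟩
  unfold varIndex
  by_contra hlt
  set a := g.orderEmbOfFin rfl
  set b := (g.image φ).orderEmbOfFin rfl
  have hlt' : b (Fin.cast hcard.symm l) < a l := by
    rw [Fin.lt_def]; omega
  have hψ : ∀ i : Fin g.card, ∃ i' : Fin g.card, φ (a i') = b (Fin.cast hcard.symm i) := by
    intro i
    have hb : b (Fin.cast hcard.symm i) ∈ g.image φ := Finset.orderEmbOfFin_mem _ rfl _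
    obtain ⟨j, hj, hji⟩ := Finset.mem_image.1 hb
    have : j ∈ Set.range a := by
      rw [Finset.range_orderEmbOfFin]
      exact hj
    obtain ⟨i', rfl⟩ := this
    exact ⟨i', hji⟩
  choose ψ hψ using hψ
  have hψinj : Function.Injective ψ := fun i i' h => by
    have := (hψ i).symm.trans ((congrArg (fun i => φ (a i)) h).trans (hψ i'))
    exact Fin.cast_injective _ (b.injective this)
  have hmap : ∀ i ∈ Finset.Iic l, ψ i ∈ Finset.Iio l := fun i hi => by
    rw [Finset.mem_Iio, ← a.lt_iff_lt]
    refine lt_of_le_of_lt ?_ hlt'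
    refine (hle _ (Finset.orderEmbOfFin_mem g rfl _)).trans ?_
    rw [hψ i]
    exact b.monotone (Fin.cast_le_cast _ |>.2 (Finset.mem_Iic.1 hi))
  have := Finset.card_le_card_of_injOn ψ hmap hψinj.injOn
  simp at this

/-! ### Classification of the minimum weight words -/

theorem eq_flipAt_of_derivative_eq_zero {k : Fin m} {F : Word m} (h : derivative k F = 0)
    (x : Point m) : F (flipAt k x) = F x := by
  have key : ∀ a b : ZMod 2, a + b = 0 → b = a := by decide
  exact key _ _ (congrFun h x)

theorem derivative_eq_zero_of_forall {k : Fin m} {F : Word m} (h : ∀ x, F (flipAt k x) = F x) :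
    derivative k F = 0 := by
  funext x
  simp [derivative, h, CharTwo.add_self_eq_zero]

theorem flatWord_flipAt_of_mem {f C : Mono m} {A : Finset (Σ _ : Fin m, Fin m)}
    (hA : A ⊆ shearPairs f) {k : Fin m} (hk : k ∈ f) {x : Point m} (hx : flatWord f C A x = 1) :
    flatWord f C A (flipAt k x) ≠ 1 := by
  intro h
  have h1 := flatWord_eq_one_iff.1 hx k hk
  have h2 := flatWord_eq_one_iff.1 h k hk
  have h3 : affineForm C A (flipAt k x) k = affineForm C A x k :=
    affineForm_congr hA fun j _ hj => flipAt_of_ne (fun h => hj (by rwa [h])) x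
  rw [flipAt_self, h3, ← h1] at h2
  simp at h2

/-- The coefficients of a word supported on a flat are those of its restriction to the flat,
a word in the free variables. -/
theorem coeff_union_of_le_flatWord {f C : Mono m} {A : Finset (Σ _ : Fin m, Fin m)}
    (hA : A ⊆ shearPairs f) {F : Word m} (hF : ∀ x, F x = 1 → flatWord f C A x = 1)
    {k : Fin m} (hk : k ∉ f) {M : Mono m} (hM : Disjoint f M) (hkM : k ∉ M) :
    coeff (fun x => F (Function.update (solve f C A x) k 0)) M = coeff F (f ∪ M) := by
  set S : Point m → Point m := fun x => Function.update (solve f C A x) k 0 with hS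
  have hSf : ∀ x, ∀ j ∉ f, j ≠ k → S x j = x j := fun x j hj hjk => by
    simp [hS, hjk, solve, hj]
  -- Only points of the flat contribute to the coefficient at f ∪ M, and each is recovered from its
  -- free part y ⊆ M by solving for the pivots. As k lies in neither f nor M, resetting it to 0
  -- changes nothing there.
  refine Finset.sum_of_injOn (fun y => pointSupport (S (exponents y))) ?_ ?_ ?_ ?_
  · intro y hy y' hy' h
    have hy : y ⊆ M := by simpa using hy
    have hy' : y' ⊆ M := by simpa using hy'
    have h2 : S (exponents y) = S (exponents y') := by
      simpa using congrArg exponents h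
    apply exponents_injective
    funext j
    by_cases hj : j ∈ M
    · have h3 := congrFun h2 j
      have hjf : j ∉ f := fun h => Finset.disjoint_left.1 hM h hj
      have hjk : j ≠ k := fun h => hkM (h ▸ hj)
      rwa [hSf _ j hjf hjk, hSf _ j hjf hjk] at h3
    · rw [exponents_of_notMem fun h => hj (hy h), exponents_of_notMem fun h => hj (hy' h)]
  · intro y hy
    have hy : y ⊆ M := by simpa using hy
    simp only [Finset.coe_powerset, Set.mem_preimage, Set.mem_powerset_iff, Finset.coe_subset]
    intro j hj
    have hj : S (exponents y) j = 1 := by simpa [pointSupport] using hj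
    by_cases hjf : j ∈ f
    · exact Finset.mem_union_left _ hjf
    · have hjk : j ≠ k := by
        rintro rfl
        simp [hS] at hj
      rw [hSf _ j hjf hjk] at hj
      refine Finset.mem_union_right _ (hy ?_)
      by_contra h
      rw [exponents_of_notMem h] at hj
      exact zero_ne_one hj
  · intro t ht hne
    by_contra hFt
    have h1 := flatWord_eq_one_iff_solve.1 (hF _ (zmod_two_ne_zero.1 hFt))
    have ht : t ⊆ f ∪ M := Finset.mem_powerset.1 ht
    have hkt : k ∉ t := fun h => by
      rcases Finset.mem_union.1 (ht h) with h | h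
      exacts [hk h, hkM h]
    refine hne ⟨t \ f, ?_, ?_⟩
    · rw [Finset.mem_coe, Finset.mem_powerset]
      intro j hj
      rw [Finset.mem_sdiff] at hj
      exact (Finset.mem_union.1 (ht hj.1)).resolve_left hj.2
    · apply exponents_injective
      dsimp only
      rw [exponents_pointSupport]
      have h2 : solve f C A (exponents (t \ f)) = exponents t := by
        rw [← h1]
        refine solve_congr hA fun j hj => ?_
        simp [exponents, hj]
      rw [hS]
      dsimp only
      rw [h2, Function.update_eq_self_iff, exponents_of_notMem hkt]
  · intro y _
    simp [hS]

/-- The minimum weight words of the Reed–Muller codes are the indicators of flats. -/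
theorem exists_eq_flatWord {r : ℕ} : ∀ {F : Word m}, DegreeLT F (r + 1) →
    2 ^ r * hammingNorm F = 2 ^ m → ∃ (f C : Mono m) (A : Finset (Σ _ : Fin m, Fin m)),
      f.card = r ∧ C ⊆ f ∧ A ⊆ shearPairs f ∧ F = flatWord f C A := by
  induction r with
  | zero =>
    intro F _ hF
    refine ⟨∅, ∅, ∅, rfl, subset_rfl, Finset.empty_subset _, ?_⟩
    have hcard : (Finset.univ.filter fun x => F x ≠ 0) = Finset.univ := by
      rw [← Finset.card_eq_iff_eq_univ]
      simpa [hammingNorm] using hF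
    funext x
    have : F x ≠ 0 := by
      have := Finset.mem_univ x
      rw [← hcard] at this
      simpa using this
    rw [zmod_two_ne_zero.1 this]
    simp [flatWord]
  | succ r ih =>
    intro F hdeg hF
    have hpos : 0 < 2 ^ m := pow_pos two_pos m
    have hF0 : F ≠ 0 := by
      rintro rfl
      rw [hammingNorm_zero, mul_zero] at hF
      exact hpos.ne hF
    have hex : (Finset.univ.filter fun k => derivative k F ≠ 0).Nonempty := by
      by_contra hd
      have hd : ∀ k, derivative k F = 0 := fun k => by
        by_contra hk
        exact hd ⟨k, by simpa using hk⟩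
      have hc := eq_const_of_derivative_eq_zero hd
      have hc1 : coeff F ∅ = 1 := by
        rw [← zmod_two_ne_zero]
        intro h1
        exact hF0 (funext fun x => by rw [hc, h1, Pi.zero_apply])
      rw [hammingNorm_const_one (fun x => (hc x).trans hc1)] at hF
      have : 2 ≤ 2 ^ (r + 1) := by
        rw [pow_succ]
        nlinarith [Nat.one_le_two_pow (n := r)]
      nlinarith
    -- The largest variable on which F depends becomes the new, last pivot.
    set k := (Finset.univ.filter fun k => derivative k F ≠ 0).max' hex with hkdef
    have hk : derivative k F ≠ 0 := by
      simpa using Finset.max'_mem _ hex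
    have hgt : ∀ j, k < j → derivative j F = 0 := fun j hj => by
      by_contra h
      exact absurd (Finset.le_max' _ j (by simpa using h)) (not_le.2 hj)
    have hsdeg : DegreeLT (derivative k F) (r + 1) := hdeg.derivative k
    -- The derivative has weight at most 2 wt(F), which is already the minimum for its degree.
    -- Equality makes F and its translate disjoint, and the derivative is a flat by induction.
    have h1 := hsdeg.le_hammingNorm hk
    have h2 := hammingNorm_derivative k F
    have h3 : 2 ^ r * (2 * hammingNorm F) = 2 ^ m := by
      rw [← hF]; ring
    have h4 : 2 ^ r * hammingNorm (derivative k F) = 2 ^ m := by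
      apply le_antisymm
      · rw [← h3]
        exact Nat.mul_le_mul_left _ (by omega)
      · rw [pow_succ] at h1
        linarith
    have h5 : ∑ x, (F x * F (flipAt k x)).val = 0 := by
      have : hammingNorm (derivative k F) = 2 * hammingNorm F :=
        Nat.eq_of_mul_eq_mul_left (pow_pos two_pos r) (h4.trans h3.symm)
      omega
    have hdisj : ∀ x, F x * F (flipAt k x) = 0 := fun x =>
      (ZMod.val_eq_zero _).1 (Finset.sum_eq_zero_iff.1 h5 x (Finset.mem_univ x))
    obtain ⟨f, C, A, hcard, hC, hA, hs⟩ := ih hsdeg h4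
    have hFs : ∀ x, F x = 1 → flatWord f C A x = 1 := by
      intro x hx
      have := hdisj x
      rw [hx, one_mul] at this
      rw [← hs, derivative, hx, this, add_zero]
    have hsinv : ∀ j, k ≤ j → ∀ x, flatWord f C A (flipAt j x) = flatWord f C A x := by
      intro j hj
      rw [← hs]
      refine eq_flipAt_of_derivative_eq_zero ?_
      rcases hj.eq_or_lt with rfl | hj
      · exact derivative_derivative _ _
      · refine derivative_eq_zero_of_forall fun x => ?_
        simp only [derivative]
        rw [flipAt_comm, eq_flipAt_of_derivative_eq_zero (hgt j hj),
          eq_flipAt_of_derivative_eq_zero (hgt j hj)]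
    have hflt : ∀ j ∈ f, j < k := by
      intro j hj
      by_contra h
      have h6 := flatWord_solve (C := C) hA 0
      exact flatWord_flipAt_of_mem hA hj h6 ((hsinv j (not_lt.1 h) _).trans h6)
    have hkf : k ∉ f := fun h => (hflt k h).ne rfl
    -- H is F on the half x_k = 0 of the flat, read as a function of the free variables below k. Its
    -- coefficient at g is that of F at f ∪ g, so the degree bound on F makes H affine.
    set H : Word m := fun x => F (Function.update (solve f C A x) k 0) with hH
    have hHinv : ∀ j, (k ≤ j ∨ j ∈ f) → derivative j H = 0 := by
      intro j hj
      refine derivative_eq_zero_of_forall fun x => ?_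
      by_cases hjf : j ∈ f
      · have : solve f C A (flipAt j x) = solve f C A x :=
          solve_congr hA fun i hi => flipAt_of_ne (fun h => hi (by rwa [h])) x
        simp only [hH, this]
      · have hkj : k ≤ j := hj.resolve_right hjf
        have hsol : solve f C A (flipAt j x) = flipAt j (solve f C A x) := by
          funext i
          by_cases hi : i ∈ f
          · have hij : i ≠ j := fun h => hjf (h ▸ hi)
            rw [flipAt_of_ne hij]
            simp only [solve, hi, if_true]
            refine affineForm_congr hA fun i' hi' _ => flipAt_of_ne ?_ x
            rintro rfl
            exact absurd (hi'.trans (hflt i hi)) (not_lt.2 hkj)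
          · by_cases hij : i = j
            · subst hij
              simp [flipAt_self, solve, hi]
            · simp [flipAt_of_ne hij, solve, hi]
        rcases hkj.eq_or_lt with h | hlt
        · simp only [hH, hsol]
          rw [← h, flipAt, Function.update_idem]
        · simp only [hH, hsol, update_flipAt hlt.ne']
          exact eq_flipAt_of_derivative_eq_zero (hgt j hlt) _
    have hHcoeff : ∀ g, coeff H g ≠ 0 → (∀ j ∈ g, j < k ∧ j ∉ f) ∧ g.card ≤ 1 := by
      intro g hg
      have hmem : ∀ j ∈ g, j < k ∧ j ∉ f := fun j hj => by
        by_contra h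
        refine hg (coeff_eq_zero_of_derivative_eq_zero (hHinv j ?_) hj)
        by_contra h7
        push Not at h7
        exact h h7
      have hd : Disjoint f g := Finset.disjoint_right.2 fun j hj => (hmem j hj).2
      refine ⟨hmem, ?_⟩
      by_contra hlt
      rw [coeff_union_of_le_flatWord hA hFs hkf hd fun h => (hmem k h).1.ne rfl] at hg
      refine hg (hdeg _ ?_)
      rw [Finset.card_union_of_disjoint hd]
      omega
    have hHaff := eq_affine_of_coeff fun g hg => (hHcoeff g hg).2
    -- The equation for the new pivot is x_k = 1 + H(x): B holds the linear part of H, and C₁ the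
    -- constant term of 1 + H.
    set B : Finset (Σ _ : Fin m, Fin m) :=
      Finset.univ.filter fun p => p.1 = k ∧ coeff H {p.2} = 1 with hB
    set C₁ : Mono m := if coeff H ∅ = 0 then {k} else ∅ with hC₁
    have hkC : k ∉ C := fun h => hkf (hC h)
    have hfirst : ∀ p ∈ A, p.1 ≠ k := fun p hp h => by
      obtain ⟨a, b⟩ := p
      exact hkf (h ▸ (mem_shearPairs.1 (hA hp)).1)
    have hform : ∀ x, ∀ j ∈ f, affineForm (C ∪ C₁) (A ∪ B) x j = affineForm C A x j := by
      intro x j hj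
      have hjk : j ≠ k := (hflt j hj).ne
      have h8 : j ∉ C₁ := by
        rw [hC₁]
        split_ifs <;> simp [hjk]
      simp [affineForm, exponents, h8, hB, hjk]
    have hformk : ∀ x, affineForm (C ∪ C₁) (A ∪ B) x k = 1 + H x := by
      intro x
      rw [hHaff x, affineForm, ← add_assoc]
      congr 1
      · rcases zmod_two_eq (coeff H ∅) with h | h
        · simp [exponents, hC₁, h]
        · simp [exponents, hC₁, h, hkC, CharTwo.add_self_eq_zero]
      · refine Finset.sum_congr rfl fun j _ => ?_
        have : (⟨k, j⟩ : Σ _ : Fin m, Fin m) ∉ A := fun h => hfirst _ h rfl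
        rcases zmod_two_eq (coeff H {j}) with h | h <;> simp [hB, this, h]
    refine ⟨insert k f, C ∪ C₁, A ∪ B, ?_, ?_, ?_, ?_⟩
    · rw [Finset.card_insert_of_notMem hkf, hcard]
    · refine Finset.union_subset (hC.trans (Finset.subset_insert _ _)) ?_
      rw [hC₁]
      split_ifs <;> simp
    · refine Finset.union_subset ?_ ?_
      · rintro ⟨a, b⟩ hab
        obtain ⟨h9, h10, h11⟩ := mem_shearPairs.1 (hA hab)
        refine mem_shearPairs.2 ⟨Finset.mem_insert_of_mem h9, h10, ?_⟩
        rw [Finset.mem_insert, not_or]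
        exact ⟨(h10.trans (hflt a h9)).ne, h11⟩
      · rintro ⟨a, b⟩ hab
        simp only [hB, Finset.mem_filter, Finset.mem_univ, true_and] at hab
        obtain ⟨rfl, hb⟩ := hab
        have h12 := (hHcoeff {b} (by simp [hb])).1 b (by simp)
        refine mem_shearPairs.2 ⟨Finset.mem_insert_self _ _, h12.1, ?_⟩
        rw [Finset.mem_insert, not_or]
        exact ⟨h12.1.ne, h12.2⟩
    · have hiff : ∀ a b : ZMod 2, (a = 1 ↔ b = 1) → a = b := by decide
      funext x
      apply hiff
      rw [flatWord_eq_one_iff, Finset.forall_mem_insert, hformk]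
      have hrest : (∀ j ∈ f, x j = affineForm (C ∪ C₁) (A ∪ B) x j) ↔ flatWord f C A x = 1 := by
        rw [flatWord_eq_one_iff]
        exact forall₂_congr fun j hj => by rw [hform x j hj]
      rw [hrest]
      -- On the flat exactly one of x and its flip at k lies in the support of F, and H decides
      -- which one.
      have hval : flatWord f C A x = 1 → (F x = 1 ↔ x k = 1 + H x) := by
        intro hx
        have hsx := flatWord_eq_one_iff_solve.1 hx
        have hd : F x + F (flipAt k x) = 1 := by
          rw [← hx, ← hs, derivative]
        rcases zmod_two_eq (x k) with h | h
        · have : H x = F x := by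
            simp only [hH, hsx]
            rw [Function.update_eq_self_iff.2 h.symm]
          rw [this, h]
          generalize F x = a
          revert a
          decide
        · have : H x = F (flipAt k x) := by
            simp only [hH, hsx, flipAt, h]
            rfl
          rw [this, h]
          generalize F (flipAt k x) = b at hd
          generalize F x = a at hd
          revert a b
          decide
      exact ⟨fun h => ⟨(hval (hFs x h)).1 h, hFs x h⟩, fun h => (hval h.2).2 h.1⟩

/-! ### The numbering D and the bit-reversal pattern -/

/-- The number with a given binary expansion, the first coordinate being the lowest digit. -/
def binaryValue (x : Point m) : ℕ := ∑ k ∈ (pointSupport x).map Fin.valEmbedding, 2 ^ k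

theorem D_add_binaryValue (x : Point m) : D x + binaryValue x = 2 ^ m := by
  have key : ∀ a : ZMod 2, (a + 1).val + (if a = 1 then 1 else 0) = 1 := by decide
  have h : (∑ k : Fin m, 2 ^ (k : ℕ)) + 1 = 2 ^ m := by
    rw [Fin.sum_univ_eq_sum_range (fun k => 2 ^ k), Nat.geomSum_eq le_rfl]
    simpa using Nat.sub_add_cancel (Nat.one_le_two_pow (n := m))
  rw [D, binaryValue, Finset.sum_map, pointSupport, Finset.sum_filter, add_right_comm,
    ← Finset.sum_add_distrib, ← h]
  congr 1
  refine Finset.sum_congr rfl fun k _ => ?_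
  calc _ = 2 ^ (k : ℕ) * ((x k + 1).val + (if x k = 1 then 1 else 0)) := by
        rw [mul_add]; simp
    _ = _ := by rw [key, mul_one]

theorem D_injective : Function.Injective (D : Point m → ℕ) := by
  intro x y h
  have hx := D_add_binaryValue x
  have hy := D_add_binaryValue y
  have h1 : binaryValue x = binaryValue y := by omega
  have h2 := Finset.map_injective _ (Finset.geomSum_injective le_rfl h1)
  simpa using congrArg exponents h2

theorem index_injective : Function.Injective (index : Mono m → ℕ) :=
  D_injective.comp exponents_injective

theorem binaryValue_lt {x y : Point m} {j : Fin m} (h : ∀ k, j < k → x k = y k) (hx : x j = 0)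
    (hy : y j = 1) : binaryValue x < binaryValue y := by
  unfold binaryValue
  rw [Finset.geomSum_lt_geomSum_iff_toColex_lt_toColex le_rfl,
    Finset.Colex.toColex_lt_toColex_iff_exists_forall_lt]
  refine ⟨j, ?_, ?_, ?_⟩
  · exact Finset.mem_map.2 ⟨j, mem_pointSupport.2 hy, rfl⟩
  · rintro hj
    obtain ⟨k, hk, hkj⟩ := Finset.mem_map.1 hj
    rw [mem_pointSupport, Fin.ext hkj, hx] at hk
    exact zero_ne_one hk
  · intro b hb hb'
    simp only [mem_pointSupport, Finset.mem_map, Fin.valEmbedding_apply] at hb hb'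
    obtain ⟨b, hbx, rfl⟩ := hb
    by_contra hlt
    rcases (not_lt.1 hlt).eq_or_lt with h1 | h1
    · rw [← Fin.ext h1, hx] at hbx
      exact zero_ne_one hbx
    · exact hb' ⟨b, (h b h1).symm.trans hbx, rfl⟩

/-- Moving variables up and adding new ones increases the binary value, and D is 2^m minus that
value. Hence f is the leading monomial of its flats. -/
theorem EmbedsBelow.index_le {g f : Mono m} (h : EmbedsBelow g f) : index f ≤ index g := by
  obtain ⟨φ, h1, h2, h3⟩ := h
  have hv : ∀ f : Mono m, binaryValue (exponents f) = ∑ k ∈ f, 2 ^ (k : ℕ) := fun f => by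
    rw [binaryValue, Finset.sum_map]
    congr 1
    ext k
    simp [pointSupport, exponents]
  have hle : ∑ k ∈ g, 2 ^ (k : ℕ) ≤ ∑ k ∈ f, 2 ^ (k : ℕ) :=
    calc _ ≤ ∑ k ∈ g, 2 ^ (φ k : ℕ) :=
          Finset.sum_le_sum fun k hk => Nat.pow_le_pow_right two_pos (h3 k hk)
      _ = ∑ k ∈ g.image φ, 2 ^ (k : ℕ) := (Finset.sum_image (f := fun k : Fin m => 2 ^ (k : ℕ)) h1).symm
      _ ≤ _ := Finset.sum_le_sum_of_subset (Finset.image_subset_iff.2 h2)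
  have hf := D_add_binaryValue (exponents f)
  have hg := D_add_binaryValue (exponents g)
  rw [hv] at hf hg
  unfold index
  omega

theorem D_mem_bitRevPattern {i : ℕ} {x : Point m} :
    D x ∈ bitRevPattern m i ↔ binaryValue (fun k => x (Fin.rev k)) < i := by
  rw [bitRevPattern, D_injective.mem_finset_image]
  have := D_add_binaryValue fun k => x (Fin.rev k)
  simp only [Finset.mem_filter, Finset.mem_univ, true_and]
  omega

theorem mem_monosIn {Y : Finset ℕ} {f : Mono m} : f ∈ monosIn Y ↔ D (exponents f) ∈ Y := by
  rw [monosIn, Finset.mem_filter]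
  simp [index]

/-- Dropping variables can only lower the bit-reversed value, so the pattern is closed under factors
for every i. -/
theorem mem_monosIn_bitRevPattern_of_subset {i : ℕ} {g f : Mono m} (h : g ⊆ f)
    (hf : f ∈ monosIn (bitRevPattern m i)) : g ∈ monosIn (bitRevPattern m i) := by
  rw [mem_monosIn, D_mem_bitRevPattern] at hf ⊢
  refine lt_of_le_of_lt ?_ hf
  refine Finset.sum_le_sum_of_subset (Finset.map_subset_map.2 ?_)
  intro k hk
  rw [mem_pointSupport] at hk ⊢
  by_cases hg : Fin.rev k ∈ g
  · simp [exponents, h hg]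
  · simp [exponents, hg] at hk

/-- A word vanishes on the pattern iff its polynomial has no monomial in the pattern. -/
theorem vanishes_on_bitRevPattern_iff {i : ℕ} {F : Word m} :
    (∀ x, D x ∈ bitRevPattern m i → F x = 0) ↔
      ∀ g ∈ monosIn (bitRevPattern m i), coeff F g = 0 := by
  constructor
  · intro h g hg
    refine Finset.sum_eq_zero fun t ht => h _ ?_
    exact mem_monosIn.1 (mem_monosIn_bitRevPattern_of_subset (Finset.mem_powerset.1 ht) hg)
  · intro h x hx
    rw [← ev_coeff F, ← exponents_pointSupport x, ev]
    refine Finset.sum_eq_zero fun g _ => ?_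
    rw [prod_exponents]
    split_ifs with hs
    · rw [h g, zero_mul]
      refine mem_monosIn_bitRevPattern_of_subset hs ?_
      rwa [mem_monosIn, exponents_pointSupport]
    · rw [mul_zero]

/-- The lexicographically least point of a flat is the one with vanishing free variables. -/
theorem binaryValue_rev_le_of_flatWord_eq_one {f C : Mono m} {A : Finset (Σ _ : Fin m, Fin m)}
    (hA : A ⊆ shearPairs f) (hC : C ⊆ f) {x : Point m} (hx : flatWord f C A x = 1) :
    binaryValue (fun k => exponents C (Fin.rev k)) ≤ binaryValue fun k => x (Fin.rev k) := by
  have hx' := flatWord_eq_one_iff.1 hx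
  have hC' := flatWord_eq_one_iff.1 (flatWord_exponents hA hC)
  -- Each pivot depends only on smaller free variables, so x agrees with C up to its first non-zero
  -- free variable j. At j the point C has 0 and x has 1, and bit reversal makes j the most
  -- significant digit where they differ.
  have hagree : ∀ k, (∀ j, j ≤ k → j ∉ f → x j = 0) → exponents C k = x k := by
    intro k hk
    by_cases hkf : k ∈ f
    · rw [hx' k hkf, hC' k hkf]
      refine affineForm_congr hA fun j hj hjf => ?_
      rw [hk j hj.le hjf, exponents_of_notMem fun h => hjf (hC h)]
    · rw [hk k le_rfl hkf, exponents_of_notMem fun h => hkf (hC h)]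
  by_cases hne : (Finset.univ.filter fun j => j ∉ f ∧ x j = 1).Nonempty
  · set j := (Finset.univ.filter fun j => j ∉ f ∧ x j = 1).min' hne
    have hj : j ∉ f ∧ x j = 1 := by
      simpa using Finset.min'_mem _ hne
    refine (binaryValue_lt (j := Fin.rev j) ?_ ?_ ?_).le
    · intro k hk
      refine hagree _ fun l hl hlf => ?_
      by_contra h
      have h1 : j ≤ l := Finset.min'_le _ l (by simpa [hlf] using zmod_two_ne_zero.1 h)
      have h2 : Fin.rev k < j := by
        rw [← Fin.rev_lt_rev, Fin.rev_rev]
        exact hk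
      exact absurd (h1.trans hl) (not_le.2 h2)
    · rw [Fin.rev_rev]
      exact exponents_of_notMem fun h => hj.1 (hC h)
    · rw [Fin.rev_rev]
      exact hj.2
  · have : exponents C = x := funext fun k => hagree k fun j _ hjf => by
      by_contra h
      exact hne ⟨j, by simpa [hjf] using zmod_two_ne_zero.1 h⟩
    rw [this]

theorem flatWord_vanishes_iff {f C : Mono m} {A : Finset (Σ _ : Fin m, Fin m)}
    (hA : A ⊆ shearPairs f) (hC : C ⊆ f) {i : ℕ} :
    (∀ x, D x ∈ bitRevPattern m i → flatWord f C A x = 0) ↔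
      C ∉ monosIn (bitRevPattern m i) := by
  rw [mem_monosIn]
  constructor
  · intro h hmem
    have := h _ hmem
    rw [flatWord_exponents hA hC] at this
    exact one_ne_zero this
  · intro h x hx
    by_contra hne
    refine h ?_
    rw [D_mem_bitRevPattern] at hx ⊢
    exact (binaryValue_rev_le_of_flatWord_eq_one hA hC (zmod_two_ne_zero.1 hne)).trans_lt hx

/-! ### The number of flats with a given pivot set -/

/-- The difference i_t - t counts the variables below x_{i_t} outside f, that is, the pairs in
`shearPairs f` over that pivot; the additional 1 accounts for its constant. -/
theorem lam_eq (f : Mono m) : lam f = 2 ^ (shearPairs f).card * 2 ^ f.card := by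
  rw [lam, ← pow_add]
  congr 1
  have hcard : f.card = ∑ _l : Fin f.card, 1 := by simp
  conv_rhs => rw [hcard]
  rw [shearPairs, Finset.card_sigma]
  have himg : f = Finset.univ.map (f.orderEmbOfFin rfl).toEmbedding := by simp
  have hsum : ∀ n : Fin m → ℕ, ∑ k ∈ f, n k = ∑ l, n (f.orderEmbOfFin rfl l) := fun n => by
    conv_lhs => rw [himg]
    exact Finset.sum_map _ _ _
  rw [hsum, ← Finset.sum_add_distrib]
  refine Finset.sum_congr rfl fun l _ => ?_
  congr 1
  rw [varIndex, Nat.add_sub_add_right]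
  set a := f.orderEmbOfFin rfl
  have h1 : (Finset.univ.filter fun j => j < a l ∧ j ∉ f) =
      Finset.Iio (a l) \ (Finset.Iio l).map a.toEmbedding := by
    ext j
    simp only [Finset.mem_filter, Finset.mem_univ, true_and, Finset.mem_sdiff, Finset.mem_Iio,
      Finset.mem_map]
    refine and_congr_right fun hj => not_congr ?_
    constructor
    · intro hjf
      obtain ⟨i, rfl⟩ : j ∈ Set.range a := by
        rw [Finset.range_orderEmbOfFin]
        exact hjf
      exact ⟨i, a.lt_iff_lt.1 hj, rfl⟩
    · rintro ⟨i, _, rfl⟩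
      exact Finset.orderEmbOfFin_mem f rfl i
  have h2 : (Finset.Iio l).map a.toEmbedding ⊆ Finset.Iio (a l) := by
    intro j hj
    obtain ⟨i, hi, rfl⟩ := Finset.mem_map.1 hj
    exact Finset.mem_Iio.2 (a.lt_iff_lt.2 (Finset.mem_Iio.1 hi))
  rw [h1, Finset.card_sdiff_of_subset h2]
  simp

/-! ### Shortening as a weight-preserving injection -/

/-- The restriction of a word to the positions outside of a pattern. -/
def restrictTo (Y : Finset ℕ) (F : Word m) : {a : Point m // D a ∉ Y} → ZMod 2 := fun a => F a.1

theorem shorten_eq_image (C : Set (Word m)) (Y : Finset ℕ) :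
    shorten C Y = restrictTo Y '' {F ∈ C | ∀ x, D x ∈ Y → F x = 0} := by
  ext c
  constructor
  · rintro ⟨F, hF, hY, rfl⟩
    exact ⟨F, ⟨hF, hY⟩, rfl⟩
  · rintro ⟨F, ⟨hF, hY⟩, rfl⟩
    exact ⟨F, hF, hY, rfl⟩

theorem restrictTo_injOn (Y : Finset ℕ) :
    Set.InjOn (restrictTo Y) {F : Word m | ∀ x, D x ∈ Y → F x = 0} := by
  intro F hF G hG h
  funext x
  by_cases hx : D x ∈ Y
  · rw [hF x hx, hG x hx]
  · exact congrFun h ⟨x, hx⟩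

theorem hammingNorm_restrictTo {Y : Finset ℕ} {F : Word m} (hF : ∀ x, D x ∈ Y → F x = 0) :
    hammingNorm (restrictTo Y F) = hammingNorm F := by
  rw [hammingNorm, hammingNorm, ← Finset.card_map (Function.Embedding.subtype _)]
  congr 1
  ext x
  simp only [Finset.mem_map, Finset.mem_filter, Finset.mem_univ, true_and,
    Function.Embedding.subtype_apply]
  constructor
  · rintro ⟨a, ha, rfl⟩
    exact ha
  · exact fun hx => ⟨⟨x, fun h => hx (hF x h)⟩, hx, rfl⟩

/-! ### Flats avoiding the pattern -/

/-- The parameters of the flats with leading monomial `f` that avoid the pattern. -/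
def flatParams (f : Mono m) (i : ℕ) : Finset (Mono m × Finset (Σ _ : Fin m, Fin m)) :=
  (f.powerset.filter fun C => C ∉ monosIn (bitRevPattern m i)) ×ˢ (shearPairs f).powerset

theorem mem_flatParams {f : Mono m} {i : ℕ} {p : Mono m × Finset (Σ _ : Fin m, Fin m)} :
    p ∈ flatParams f i ↔
      (p.1 ⊆ f ∧ p.1 ∉ monosIn (bitRevPattern m i)) ∧ p.2 ⊆ shearPairs f := by
  rw [flatParams, Finset.mem_product, Finset.mem_filter, Finset.mem_powerset, Finset.mem_powerset]

/-- The indicators of the flats with leading monomial `f` that avoid the pattern. -/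
def flatWords (f : Mono m) (i : ℕ) : Finset (Word m) :=
  (flatParams f i).image fun p => flatWord f p.1 p.2

theorem mem_flatWords {f : Mono m} {i : ℕ} {F : Word m} :
    F ∈ flatWords f i ↔ ∃ C A, C ⊆ f ∧ C ∉ monosIn (bitRevPattern m i) ∧ A ⊆ shearPairs f ∧
      flatWord f C A = F := by
  rw [flatWords, Finset.mem_image]
  constructor
  · rintro ⟨p, hp, rfl⟩
    obtain ⟨⟨h1, h2⟩, h3⟩ := mem_flatParams.1 hp
    exact ⟨_, _, h1, h2, h3, rfl⟩
  · rintro ⟨C, A, h1, h2, h3, rfl⟩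
    exact ⟨(C, A), mem_flatParams.2 ⟨⟨h1, h2⟩, h3⟩, rfl⟩

theorem card_flatWords (f : Mono m) (i : ℕ) :
    ((flatWords f i).card : ℚ) = (lam f : ℚ) * (1 - (beta f i : ℚ) / 2 ^ f.card) := by
  have hinj : Set.InjOn (fun p : Mono m × Finset (Σ _ : Fin m, Fin m) => flatWord f p.1 p.2)
      (flatParams f i) := by
    intro p hp q hq h
    obtain ⟨⟨h1, -⟩, h2⟩ := mem_flatParams.1 hp
    obtain ⟨⟨h3, -⟩, h4⟩ := mem_flatParams.1 hq
    obtain ⟨h5, h6⟩ := flatWord_injective h2 h1 h4 h3 h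
    exact Prod.ext h5 h6
  have hcount : (f.powerset.filter fun C => C ∉ monosIn (bitRevPattern m i)).card + beta f i =
      2 ^ f.card := by
    rw [beta, add_comm, Finset.card_filter_add_card_filter_not, Finset.card_powerset]
  have hcount' : ((f.powerset.filter fun C => C ∉ monosIn (bitRevPattern m i)).card : ℚ) =
      2 ^ f.card - beta f i := by
    rw [eq_sub_iff_add_eq]
    exact_mod_cast hcount
  rw [flatWords, Finset.card_image_of_injOn hinj, flatParams, Finset.card_product,
    Finset.card_powerset, lam_eq]
  push_cast
  rw [hcount']
  field_simp

theorem vanishes_of_mem_flatWords {f : Mono m} {i : ℕ} {F : Word m} (hF : F ∈ flatWords f i) :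
    ∀ x, D x ∈ bitRevPattern m i → F x = 0 := by
  obtain ⟨C, A, h1, h2, h3, rfl⟩ := mem_flatWords.1 hF
  exact (flatWord_vanishes_iff h3 h1).2 h2

theorem flatWord_mem_flatWords {f C : Mono m} {A : Finset (Σ _ : Fin m, Fin m)} {i : ℕ}
    (hC : C ⊆ f) (hA : A ⊆ shearPairs f)
    (h : ∀ x, D x ∈ bitRevPattern m i → flatWord f C A x = 0) :
    flatWord f C A ∈ flatWords f i :=
  mem_flatWords.2 ⟨C, A, hC, (flatWord_vanishes_iff hA hC).1 h, hA, rfl⟩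

theorem hammingNorm_of_mem_flatWords {f : Mono m} {i : ℕ} {F : Word m} (hF : F ∈ flatWords f i) :
    hammingNorm F = hammingNorm (ev (toPoly f)) := by
  obtain ⟨C, A, h1, h2, h3, rfl⟩ := mem_flatWords.1 hF
  exact hammingNorm_flatWord_eq h3

theorem embedsBelow_of_coeff_flatWords_ne_zero {f g : Mono m} {i : ℕ} {F : Word m}
    (hF : F ∈ flatWords f i) (h : coeff F g ≠ 0) : EmbedsBelow g f := by
  obtain ⟨C, A, h1, h2, h3, rfl⟩ := mem_flatWords.1 hF
  exact embedsBelow_of_coeff_flatWord_ne_zero h3 h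

theorem coeff_flatWords_self {f : Mono m} {i : ℕ} {F : Word m} (hF : F ∈ flatWords f i) :
    coeff F f = 1 := by
  obtain ⟨C, A, h1, h2, h3, rfl⟩ := mem_flatWords.1 hF
  exact coeff_flatWord_self h3 h1

/-- The pivot set is recovered from the word as the monomial of least number; a common word would
make each of f and g precede the other. -/
theorem disjoint_flatWords {f g : Mono m} (h : f ≠ g) (i : ℕ) :
    Disjoint (flatWords f i) (flatWords g i) := by
  rw [Finset.disjoint_left]
  intro F hf hg
  have h1 : EmbedsBelow g f := embedsBelow_of_coeff_flatWords_ne_zero hf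
    (by rw [coeff_flatWords_self hg]; exact one_ne_zero)
  have h2 : EmbedsBelow f g := embedsBelow_of_coeff_flatWords_ne_zero hg
    (by rw [coeff_flatWords_self hf]; exact one_ne_zero)
  exact h (index_injective (h1.index_le.antisymm h2.index_le))

theorem degreeLT_of_hasOrder {I : Finset (Mono m)} {r : ℕ} (hI : HasOrder I r) {F : Word m}
    (hF : ∀ g, g ∉ I → coeff F g = 0) : DegreeLT F (r + 1) := by
  intro g hg
  refine hF g fun hgI => ?_
  have := hI.2 ⟨g, hgI, rfl⟩
  omega

theorem exists_mem_flatWords {F : Word m} {r i : ℕ} (hF : DegreeLT F (r + 1))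
    (hw : hammingNorm F = 2 ^ (m - r)) (hr : r ≤ m)
    (hY : ∀ x, D x ∈ bitRevPattern m i → F x = 0) :
    ∃ f : Mono m, f.card = r ∧ F ∈ flatWords f i := by
  have hw' : 2 ^ r * hammingNorm F = 2 ^ m := by
    rw [hw, ← pow_add, Nat.add_sub_cancel' hr]
  obtain ⟨f, C, A, hcard, hC, hA, rfl⟩ := exists_eq_flatWord hF hw'
  exact ⟨f, hcard, flatWord_mem_flatWords hC hA hY⟩

/-- The shortened minimum weight words with leading monomial `f` are given by the flats. -/
theorem vanishing_image_T_eq {J : Finset (Mono m)} (hJ : IsDecreasing J) {r : ℕ}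
    (hJr : HasOrder J r) {f : Mono m} (hf : f.card = r) (hfJ : f ∈ J) (i : ℕ) :
    {F ∈ ev '' T J f | ∀ x, D x ∈ bitRevPattern m i → F x = 0} = ↑(flatWords f i) := by
  have hr : r ≤ m := by
    rw [← hf]
    simpa using Finset.card_le_univ f
  ext F
  constructor
  · rintro ⟨⟨u, ⟨hlead, huf, hsupp, hw⟩, rfl⟩, hY⟩
    rw [hammingNorm_toPoly, hf] at hw
    obtain ⟨g, hg, hFg⟩ := exists_mem_flatWords
      (degreeLT_of_hasOrder hJr (by rwa [coeff_ev])) hw hr hY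
    -- The coefficient of f is 1, so f embeds below g and g has the smaller or equal number; the
    -- leading term condition of T(f) excludes strict inequality.
    have hgf : g = f := by
      have h1 := embedsBelow_of_coeff_flatWords_ne_zero (g := f) hFg
        (by rw [coeff_ev, huf]; exact one_ne_zero)
      have h2 : ¬ index g < index f := fun hlt => by
        have := coeff_flatWords_self hFg
        rw [coeff_ev, hlead g hlt] at this
        exact zero_ne_one this
      exact index_injective (h1.index_le.antisymm (not_lt.1 h2))
    rwa [← hgf]
  · intro hF
    rw [Finset.mem_coe] at hF
    refine ⟨⟨coeff F, ⟨?_, coeff_flatWords_self hF, ?_, ?_⟩, ev_coeff F⟩,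
      vanishes_of_mem_flatWords hF⟩
    · intro g hg
      by_contra h
      exact absurd (embedsBelow_of_coeff_flatWords_ne_zero hF h).index_le (not_le.2 hg)
    · intro g hg
      by_contra h
      exact hg (hJ _ _ (embedsBelow_of_coeff_flatWords_ne_zero hF h).prec hfJ)
    · rw [ev_coeff]
      exact hammingNorm_of_mem_flatWords hF

/-- Every monomial of the flat is ≼ f, hence in the decreasing union; those in the pattern have
coefficient 0 because the flat avoids it, so the rest lie in I. -/
theorem mem_code_of_mem_flatWords {I : Finset (Mono m)} {i : ℕ}
    (hdec : IsDecreasing (I ∪ monosIn (bitRevPattern m i))) {f : Mono m} (hf : f ∈ I)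
    {F : Word m} (hF : F ∈ flatWords f i) : F ∈ code I := by
  rw [mem_code_iff]
  intro g hg
  by_contra h
  have h1 := hdec _ _ (embedsBelow_of_coeff_flatWords_ne_zero hF h).prec
    (Finset.mem_union_left _ hf)
  exact h (vanishes_on_bitRevPattern_iff.1 (vanishes_of_mem_flatWords hF) g
    ((Finset.mem_union.1 h1).resolve_left hg))

/-- The minimum weight words of a decreasing code that vanish on the pattern. -/
theorem vanishing_code_eq {I : Finset (Mono m)} {r i : ℕ}
    (hdec : IsDecreasing (I ∪ monosIn (bitRevPattern m i))) (hord : HasOrder I r) :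
    {F ∈ {F ∈ (code I : Set (Word m)) | ∀ x, D x ∈ bitRevPattern m i → F x = 0} |
      hammingNorm F = 2 ^ (m - r)} =
    ↑((I.filter fun f => f.card = r).biUnion fun f => flatWords f i) := by
  obtain ⟨f₀, -, hf₀⟩ := hord.1
  have hr : r ≤ m := by
    rw [← hf₀]
    simpa using Finset.card_le_univ f₀
  ext F
  simp only [Finset.coe_biUnion, Set.mem_iUnion, Finset.mem_coe, Finset.mem_filter]
  constructor
  · rintro ⟨⟨hF, hY⟩, hw⟩
    have hF' := mem_code_iff.1 hF
    obtain ⟨f, hf, hFf⟩ := exists_mem_flatWords (degreeLT_of_hasOrder hord hF') hw hr hY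
    refine ⟨f, ⟨?_, hf⟩, hFf⟩
    by_contra hfI
    have := hF' f hfI
    rw [coeff_flatWords_self hFf] at this
    exact one_ne_zero this
  · rintro ⟨f, ⟨hfI, hf⟩, hFf⟩
    refine ⟨⟨mem_code_of_mem_flatWords hdec hfI hFf, vanishes_of_mem_flatWords hFf⟩, ?_⟩
    rw [hammingNorm_of_mem_flatWords hFf, hammingNorm_toPoly, hf]

end PolarShortening

/-! ### The theorem -/

open PolarShortening in
theorem theorem2 (m r i : ℕ) (hi : i ≤ 2 ^ m) (I : Finset (Mono m))
    (hdec : IsDecreasing (I ∪ monosIn (bitRevPattern m i))) (hord : HasOrder I r) :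
    (∀ f : Mono m, f.card = r →
      ∀ J : Finset (Mono m), IsDecreasing J → HasOrder J r → f ∈ J →
        ((TS J f (bitRevPattern m i)).ncard : ℚ) =
          (lam f : ℚ) * (1 - (beta f i : ℚ) / 2 ^ r)) ∧
    ((numWeight (2 ^ (m - r)) (shortenedCode I (bitRevPattern m i)) : ℕ) : ℚ) =
      ∑ f ∈ I.filter (fun f => f.card = r),
        (lam f : ℚ) * (1 - (beta f i : ℚ) / 2 ^ r) ∧
    ((∃ f ∈ I, f.card = r ∧ f ∉ monosIn (bitRevPattern m i)) →
      IsLeast {w : ℕ | ∃ c ∈ shortenedCode I (bitRevPattern m i), c ≠ 0 ∧ hammingNorm c = w}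
        (2 ^ (m - r))) := by
  refine ⟨?_, ?_, ?_⟩
  · intro f hf J hJ hJr hfJ
    rw [TS, shorten_eq_image,
      Set.InjOn.ncard_image ((restrictTo_injOn _).mono fun F hF => hF.2),
      vanishing_image_T_eq hJ hJr hf hfJ, Set.ncard_coe_finset, card_flatWords, hf]
  · have himage : {c ∈ shortenedCode I (bitRevPattern m i) | hammingNorm c = 2 ^ (m - r)} =
        restrictTo (bitRevPattern m i) ''
          {F ∈ {F ∈ (code I : Set (Word m)) | ∀ x, D x ∈ bitRevPattern m i → F x = 0} |
            hammingNorm F = 2 ^ (m - r)} := by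
      rw [shortenedCode, shorten_eq_image]
      ext c
      constructor
      · rintro ⟨⟨F, hF, rfl⟩, hw⟩
        exact ⟨F, ⟨hF, by rwa [hammingNorm_restrictTo hF.2] at hw⟩, rfl⟩
      · rintro ⟨F, ⟨hF, hw⟩, rfl⟩
        exact ⟨⟨F, hF, rfl⟩, by rwa [hammingNorm_restrictTo hF.2]⟩
    rw [numWeight, himage,
      Set.InjOn.ncard_image ((restrictTo_injOn _).mono fun F hF => hF.1.2),
      vanishing_code_eq hdec hord, Set.ncard_coe_finset,
      Finset.card_biUnion fun f _ g _ h => disjoint_flatWords h i, Nat.cast_sum]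
    refine Finset.sum_congr rfl fun f hf => ?_
    rw [card_flatWords, (Finset.mem_filter.1 hf).2]
  · rintro ⟨f, hfI, hf, hfY⟩
    have hr : r ≤ m := by
      rw [← hf]
      simpa using Finset.card_le_univ f
    rw [shortenedCode, shorten_eq_image]
    refine ⟨?_, ?_⟩
    · have hF : flatWord f f ∅ ∈ flatWords f i :=
        mem_flatWords.2 ⟨f, ∅, subset_rfl, hfY, Finset.empty_subset _, rfl⟩
      have hY := vanishes_of_mem_flatWords hF
      have hw : hammingNorm (restrictTo (bitRevPattern m i) (flatWord f f ∅)) = 2 ^ (m - r) := by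
        rw [hammingNorm_restrictTo hY, hammingNorm_of_mem_flatWords hF, hammingNorm_toPoly, hf]
      refine ⟨_, ⟨_, ⟨mem_code_of_mem_flatWords hdec hfI hF, hY⟩, rfl⟩, ?_, hw⟩
      rw [← hammingNorm_ne_zero_iff, hw]
      exact (pow_pos two_pos _).ne'
    · rintro w ⟨_, ⟨F, ⟨hF, hY⟩, rfl⟩, hne, rfl⟩
      have hF0 : F ≠ 0 := by
        rintro rfl
        exact hne rfl
      have h := (degreeLT_of_hasOrder hord (mem_code_iff.1 hF)).le_hammingNorm hF0
      rw [hammingNorm_restrictTo hY]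
      have hm : 2 ^ m = 2 ^ r * 2 ^ (m - r) := by
        rw [← pow_add, Nat.add_sub_cancel' hr]
      rw [hm, pow_succ] at h
      exact Nat.le_of_mul_le_mul_left (by linarith) (pow_pos two_pos r)
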